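/- Let $V$ be a nonzero finite-dimensional real vector space, let $0\neq e\in V$, and let $p$ be a real homogeneous polynomial of degree $n$ on $V$ that is hyperbolic relative to $e$, that is, $p(e)\neq 0$ and for every $x\in V$ all the roots of the univariate polynomial $t\mapsto p(te-x)$ are real. Let $\lambda:V\to\mathbb{R}^n$ be the eigenvalue map of $p$ relative to $e$: $\lambda(x)$ is the vector of the roots of $t\mapsto p(te-x)$, counted with multiplicity and written in decreasing order. Suppose that $p$ is complete relative to $e$, that is, $\lambda(x)=0$ implies $x=0$. Let $\mathbb{R}^n$ carry its usual inner product and norm, and define $$\langle x,y\rangle:=\tfrac14\left\{\|\lambda(x+y)\|^2-\|\lambda(x-y)\|^2\right\}\qquad (x,y\in V).$$ Then $\langle\cdot,\cdot\rangle$ is an inner product on $V$. With respect to this inner product and its norm, $(V,\mathbb{R}^n,\lambda)$ is a semi-FTvN system, that is, $\|\lambda(x)\|=\|x\|$ and $\langle x,y\rangle\le\langle\lambda(x),\lambda(y)\rangle$ for all $x,y\in V$. Moreover, the hyperbolicity cone $K:=\{x\in V:\lambda(x)\geq 0\}$ (where the inequality is coordinatewise) is a proper cone, that is, a closed convex cone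 that is pointed ($K\cap -K=\{0\}$) and has nonempty interior. -/

import Mathlib

namespace HypPoly

section Polynomials

variable {V : Type*} [AddCommGroup V] [Module ℝ V] {ι : Type*}

/-- The value at `v : V` of the polynomial on `V` that is given, in the coordinates of the
basis `b`, by `p`. -/
noncomputable def value (b : Module.Basis ι ℝ V) (p : MvPolynomial ι ℝ) (v : V) : ℝ :=
  MvPolynomial.eval (fun i => b.repr v i) p

/-- The univariate polynomial `t ↦ p (t e - x)`. -/
noncomputable def linePoly (b : Module.Basis ι ℝ V) (p : MvPolynomial ι ℝ) (e x : V) :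
    Polynomial ℝ :=
  MvPolynomial.aeval
    (fun i => Polynomial.C (b.repr e i) * Polynomial.X - Polynomial.C (b.repr x i)) p

/-- `linePoly b p e x` is indeed the polynomial `t ↦ p (t e - x)`. -/
theorem eval_linePoly (b : Module.Basis ι ℝ V) (p : MvPolynomial ι ℝ) (e x : V) (t : ℝ) :
    (linePoly b p e x).eval t = value b p (t • e - x) := by
  induction p using MvPolynomial.induction_on with
  | C a => simp [linePoly, value]
  | add p q hp hq =>
    simp only [linePoly, value, map_add, Polynomial.eval_add] at hp hq ⊢
    rw [hp, hq]
  | mul_X p i hp =>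
    rw [linePoly, value] at hp ⊢
    rw [map_mul, map_mul, Polynomial.eval_mul, hp, MvPolynomial.aeval_X, MvPolynomial.eval_X]
    congr 1
    rw [map_sub, map_smul, Finsupp.sub_apply, Finsupp.smul_apply, smul_eq_mul, mul_comm t]
    simp only [Polynomial.eval_sub, Polynomial.eval_mul, Polynomial.eval_C, Polynomial.eval_X]

/-- `p`, homogeneous of degree `n`, is hyperbolic relative to `e`: `p e ≠ 0`, and for every `x`
all complex roots of `t ↦ p (t e - x)` are real. -/
structure IsHyperbolic (b : Module.Basis ι ℝ V) (p : MvPolynomial ι ℝ) (n : ℕ) (e : V) :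
    Prop where
  homogeneous : p.IsHomogeneous n
  value_ne_zero : value b p e ≠ 0
  roots_real : ∀ (x : V) (z : ℂ), Polynomial.aeval z (linePoly b p e x) = 0 → z.im = 0

/-- The eigenvalue map: the vector of roots (with multiplicity) of `t ↦ p (t e - x)`, in
decreasing order. For `p` hyperbolic of degree `n` there are exactly `n` roots, so the
default value `0` is never used. -/
noncomputable def eigenvalueMap (b : Module.Basis ι ℝ V) (p : MvPolynomial ι ℝ) (n : ℕ) (e : V)
    (x : V) : EuclideanSpace ℝ (Fin n) :=
  WithLp.toLp 2 fun i => ((linePoly b p e x).roots.sort (· ≥ ·)).getD i 0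

/-- Completeness of `p` relative to `e`: the eigenvalue map vanishes only at `0`. -/
def IsComplete (b : Module.Basis ι ℝ V) (p : MvPolynomial ι ℝ) (n : ℕ) (e : V) : Prop :=
  ∀ x : V, eigenvalueMap b p n e x = 0 → x = 0

/-- The hyperbolicity cone `{x | λ(x) ≥ 0}`, the inequality being coordinatewise. -/
def hyperbolicityCone (b : Module.Basis ι ℝ V) (p : MvPolynomial ι ℝ) (n : ℕ) (e : V) : Set V :=
  {x | ∀ i, 0 ≤ eigenvalueMap b p n e x i}

end Polynomials

/-- A semi-FTvN system `(V, W, l)`: `l` is norm-preserving and inner product expanding. -/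
structure IsSemiFTvN {V W : Type*} [NormedAddCommGroup V] [InnerProductSpace ℝ V]
    [NormedAddCommGroup W] [InnerProductSpace ℝ W] (l : V → W) : Prop where
  norm_map : ∀ x, ‖l x‖ = ‖x‖
  inner_le : ∀ x y, inner ℝ x y ≤ inner ℝ (l x) (l y)

/-- A proper cone: a closed convex cone that is pointed (`K ∩ -K = {0}`) and has nonempty
interior. -/
structure IsProperCone {V : Type*} [NormedAddCommGroup V] [InnerProductSpace ℝ V]
    (K : Set V) : Prop where
  isClosed : IsClosed K
  convex : Convex ℝ K
  smul_mem : ∀ t : ℝ, 0 ≤ t → ∀ x ∈ K, t • x ∈ K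
  pointed : ∀ x, x ∈ K ∧ -x ∈ K ↔ x = 0
  interior_nonempty : (interior K).Nonempty

end HypPoly

/-! Symmetric polynomials in the eigenvalues λ(x) are polynomials in x, since the elementary ones
are, up to sign, coefficients of p(te - x)/p(e). In particular ∑ λ_i(x)² is a quadratic form. Its
polar form B is the proposed inner product, and completeness makes it definite.

The core is that x ↦ ∑ c_i λ_i(x) is subadditive for every decreasing c
(`sum_mul_eigenvalueMap_add_le`). The product over permutations σ of ∑ c_{σ i} λ_i(x) is symmetric,
hence a polynomial q in x. If S = ∑ c_i > 0, then q is hyperbolic relative to e, with eigenvalues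
S⁻¹ ∑ c_{σ i} λ_i(x); by rearrangement the largest is the one for σ = 1. Gårding's theorem, that the
largest eigenvalue is subadditive, applied to q gives the claim. The trace ∑ λ_i is linear, so c can
be shifted by a constant to make S positive.

Taking c = λ(x+y) gives ‖λ(x+y)‖² ≤ ⟨λ(x+y), λ(x)+λ(y)⟩, hence ‖λ(x+y)‖² ≤ ‖λ(x)+λ(y)‖², which
expands to B(x,y) ≤ ⟨λ(x), λ(y)⟩. Then λ is 1-Lipschitz, so K is closed and e, all of whose
eigenvalues are 1, is interior to K. The choice c = (0, …, 0, -1) makes K closed under addition, and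
completeness makes it pointed. -/

open MvPolynomial in
theorem MvPolynomial.IsHomogeneous.eval_smul_eq {ι R : Type*} [Fintype ι] [CommRing R]
    {q : MvPolynomial ι R} {N : ℕ} (hq : q.IsHomogeneous N) (t : R) (v : ι → R) :
    eval (t • v) q = t ^ N * eval v q := by
  rw [eval_eq', eval_eq', Finset.mul_sum]
  refine Finset.sum_congr rfl fun d hd => ?_
  have h : d.degree = N := by
    rw [Finsupp.degree_eq_weight_one]
    exact hq (mem_support_iff.1 hd)
  rw [Finsupp.degree_eq_sum] at h
  simp only [Pi.smul_apply, smul_eq_mul, mul_pow, Finset.prod_mul_distrib,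
    Finset.prod_pow_eq_pow_sum, h]
  ring

-- Expand q(tv) into homogeneous components and compare coefficients of t^N. This serves for
-- polynomials known only through their values.
open MvPolynomial in
theorem MvPolynomial.isHomogeneous_of_eval_smul {ι K : Type*} [Field K] [Infinite K]
    {q : MvPolynomial ι K} {N : ℕ} [Fintype ι]
    (h : ∀ (t : K) (v : ι → K), eval (t • v) q = t ^ N * eval v q) :
    q.IsHomogeneous N := by
  have hsum := sum_homogeneousComponent q
  suffices q = homogeneousComponent N q by
    rw [this]; exact homogeneousComponent_isHomogeneous N q
  refine funext fun v => ?_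
  -- Large enough to cover every degree of q and also N, which may exceed the total degree.
  set M := q.totalDegree + N + 1
  have hM : ∑ d ∈ Finset.range M, homogeneousComponent d q = q := by
    conv_rhs => rw [← hsum]
    symm
    refine Finset.sum_subset (Finset.range_mono (by omega)) fun d _ hd => ?_
    exact homogeneousComponent_eq_zero _ _ (by simpa using hd)
  have key : (∑ d ∈ Finset.range M, Polynomial.C (eval v (homogeneousComponent d q)) *
      Polynomial.X ^ d) = Polynomial.C (eval v q) * Polynomial.X ^ N := by
    refine Polynomial.funext fun t => ?_
    rw [Polynomial.eval_finsetSum]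
    simp only [Polynomial.eval_mul, Polynomial.eval_C, Polynomial.eval_pow, Polynomial.eval_X]
    rw [mul_comm, ← h]
    conv_rhs => rw [← hM, map_sum]
    refine Finset.sum_congr rfl fun d _ => ?_
    rw [(homogeneousComponent_isHomogeneous d q).eval_smul_eq, mul_comm]
  have := congrArg (fun r => Polynomial.coeff r N) key
  simp only [Polynomial.finsetSum_coeff, Polynomial.coeff_C_mul_X_pow] at this
  rw [Finset.sum_ite_eq, if_pos (by simp [M])] at this
  simpa using this.symm

/-! ### Restriction of a homogeneous polynomial to lines -/

namespace HypPoly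

/-- The univariate polynomial `t ↦ q (t a - x)`. -/
noncomputable def pencil {ι R : Type*} [CommRing R] (q : MvPolynomial ι R) (a x : ι → R) :
    Polynomial R :=
  MvPolynomial.aeval (fun i => Polynomial.C (a i) * Polynomial.X - Polynomial.C (x i)) q

section Pencil

variable {ι R : Type*} [CommRing R]

theorem map_pencil {S : Type*} [CommRing S] (f : R →+* S) (q : MvPolynomial ι R)
    (a x : ι → R) :
    (pencil q a x).map f = pencil (MvPolynomial.map f q) (f ∘ a) (f ∘ x) := by
  induction q using MvPolynomial.induction_on with
  | C r => simp [pencil]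
  | add p q hp hq => simp only [pencil, map_add, Polynomial.map_add] at hp hq ⊢; rw [hp, hq]
  | mul_X p i hp =>
    simp only [pencil, map_mul, Polynomial.map_mul] at hp ⊢; rw [hp]; simp

theorem eval_pencil (q : MvPolynomial ι R) (a x : ι → R) (t : R) :
    (pencil q a x).eval t = MvPolynomial.eval (t • a - x) q := by
  induction q using MvPolynomial.induction_on with
  | C r => simp [pencil]
  | add p q hp hq => simp only [pencil, map_add, Polynomial.eval_add] at hp hq ⊢; rw [hp, hq]
  | mul_X p i hp =>
    simp only [pencil, map_mul, Polynomial.eval_mul] at hp ⊢; rw [hp]; simp [mul_comm t]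

variable [Fintype ι] {q : MvPolynomial ι R} {N : ℕ}

theorem natDegree_pencil_le (hq : q.IsHomogeneous N) (a x : ι → R) :
    (pencil q a x).natDegree ≤ N ∧ (pencil q a x).coeff N = MvPolynomial.eval a q := by
  have hlin : ∀ i, (Polynomial.C (a i) * Polynomial.X - Polynomial.C (x i)).natDegree ≤ 1 := by
    intro i; compute_degree
  have hdeg : ∀ d ∈ q.support, ∑ i, d i = N := by
    intro d hd
    rw [← Finsupp.degree_eq_sum, Finsupp.degree_eq_weight_one]
    exact hq (MvPolynomial.mem_support_iff.1 hd)
  have hprod : ∀ d ∈ q.support,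
      (∏ i, (Polynomial.C (a i) * Polynomial.X - Polynomial.C (x i)) ^ d i).natDegree ≤ N ∧
      (∏ i, (Polynomial.C (a i) * Polynomial.X - Polynomial.C (x i)) ^ d i).coeff N
        = ∏ i, a i ^ d i := by
    intro d hd
    have hd' := hdeg d hd
    clear hd
    have hpow : ∀ i, ((Polynomial.C (a i) * Polynomial.X - Polynomial.C (x i)) ^ d i).natDegree
        ≤ d i ∧ ((Polynomial.C (a i) * Polynomial.X - Polynomial.C (x i)) ^ d i).coeff (d i)
          = a i ^ d i := by
      intro i
      refine ⟨(Polynomial.natDegree_pow_le_of_le _ (hlin i)).trans (mul_one _).le, ?_⟩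
      have := Polynomial.coeff_pow_of_natDegree_le (m := d i) (hlin i)
      rw [mul_one] at this
      rw [this]
      congr 1
      rw [Polynomial.coeff_sub, Polynomial.coeff_C_mul, Polynomial.coeff_X_one,
        Polynomial.coeff_C_of_ne_zero one_ne_zero, mul_one, sub_zero]
    subst hd'
    induction (Finset.univ : Finset ι) using Finset.cons_induction with
    | empty => simp
    | cons i s hi ih =>
      rw [Finset.prod_cons, Finset.prod_cons, Finset.sum_cons]
      refine ⟨Polynomial.natDegree_mul_le_of_le (hpow i).1 ih.1, ?_⟩
      rw [Polynomial.coeff_mul_add_eq_of_natDegree_le (hpow i).1 ih.1, (hpow i).2, ih.2]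
  have hexp : pencil q a x = ∑ d ∈ q.support, Polynomial.C (q.coeff d) *
      ∏ i, (Polynomial.C (a i) * Polynomial.X - Polynomial.C (x i)) ^ d i := by
    rw [pencil, MvPolynomial.aeval_def, MvPolynomial.eval₂_eq']; rfl
  rw [hexp]
  constructor
  · refine Polynomial.natDegree_sum_le_of_forall_le _ _ fun d hd => ?_
    exact (Polynomial.natDegree_C_mul_le _ _).trans (hprod d hd).1
  · rw [Polynomial.finsetSum_coeff, MvPolynomial.eval_eq']
    refine Finset.sum_congr rfl fun d hd => ?_
    rw [Polynomial.coeff_C_mul, (hprod d hd).2]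

theorem natDegree_pencil (hq : q.IsHomogeneous N) {a : ι → R} (x : ι → R)
    (ha : MvPolynomial.eval a q ≠ 0) :
    (pencil q a x).natDegree = N ∧ (pencil q a x).leadingCoeff = MvPolynomial.eval a q := by
  obtain ⟨h1, h2⟩ := natDegree_pencil_le hq a x
  have h3 : (pencil q a x).natDegree = N :=
    Polynomial.natDegree_eq_of_le_of_coeff_ne_zero h1 (by rwa [h2])
  exact ⟨h3, by rw [Polynomial.leadingCoeff, h3, h2]⟩

end Pencil

/-! ### Roots along a path stay in a half-plane -/

section Homotopy

theorem continuous_eval_left {ι : Type*} {q : MvPolynomial ι ℂ} {X : Type*} [TopologicalSpace X] {f : X → ι → ℂ}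
    (hf : Continuous f) : Continuous fun t => MvPolynomial.eval (f t) q :=
  (MvPolynomial.continuous_eval q).comp hf

variable {ι : Type*} [Fintype ι] {q : MvPolynomial ι ℂ} {N : ℕ}

/-- Each root r lies in the open lower half-plane, so |s - r| ≥ Im s. The bound turns nonvanishing
into a closed condition and replaces continuity of roots. -/
theorem norm_eval_ge_of_roots (hq : q.IsHomogeneous N) {a x : ι → ℂ}
    (ha : MvPolynomial.eval a q ≠ 0)
    (h : ∀ s : ℂ, 0 ≤ s.im → MvPolynomial.eval (s • a - x) q ≠ 0) (s : ℂ) (hs : 0 ≤ s.im) :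
    ‖MvPolynomial.eval a q‖ * s.im ^ N ≤ ‖MvPolynomial.eval (s • a - x) q‖ := by
  obtain ⟨h1, h2⟩ := natDegree_pencil hq x ha
  have hsp := IsAlgClosed.splits (pencil q a x)
  have h0 : pencil q a x ≠ 0 := by
    intro h0; rw [h0] at h2; exact ha (by simpa using h2.symm)
  rw [← eval_pencil, hsp.eval_eq_prod_roots, h2, norm_mul]
  refine mul_le_mul_of_nonneg_left ?_ (norm_nonneg _)
  rw [← h1, hsp.natDegree_eq_card_roots]
  have hroots : ∀ r ∈ (pencil q a x).roots, r.im < 0 := by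
    intro r hr
    by_contra hc
    refine h r (not_lt.1 hc) ?_
    rw [← eval_pencil]
    exact (Polynomial.mem_roots'.1 hr).2
  clear h0
  generalize (pencil q a x).roots = m at hroots
  induction m using Multiset.induction_on with
  | empty => simp
  | cons r m ih =>
    rw [Multiset.card_cons, pow_succ, Multiset.map_cons, Multiset.prod_cons, norm_mul, mul_comm]
    refine mul_le_mul ?_ (ih fun r hr => hroots r (Multiset.mem_cons_of_mem hr))
      (pow_nonneg hs _) (norm_nonneg _)
    have := hroots r (Multiset.mem_cons_self _ _)
    calc s.im ≤ (s - r).im := by simp; linarith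
      _ ≤ ‖s - r‖ := Complex.im_le_norm _

/-- If the roots of `s ↦ q (s a - u τ)` never become real along a path `u` and start in the open
lower half-plane, then they stay there. -/
theorem eval_ne_zero_of_path (hq : q.IsHomogeneous N) {a : ι → ℂ}
    (ha : MvPolynomial.eval a q ≠ 0) {u : ℝ → ι → ℂ} (hu : Continuous u)
    (hreal : ∀ (τ s : ℝ), MvPolynomial.eval ((s : ℂ) • a - u τ) q ≠ 0)
    (h0 : ∀ s : ℂ, 0 ≤ s.im → MvPolynomial.eval (s • a - u 0) q ≠ 0) (τ : ℝ) (s : ℂ)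
    (hs : 0 ≤ s.im) : MvPolynomial.eval (s • a - u τ) q ≠ 0 := by
  set A : Set ℝ := {τ | ∀ s : ℂ, 0 ≤ s.im → MvPolynomial.eval (s • a - u τ) q ≠ 0} with hA
  -- For Im s > 0 the bound forces nonvanishing; on the real axis, where it may be vacuous, `hreal`
  -- takes over.
  have hA' : A = ⋂ s ∈ {s : ℂ | 0 ≤ s.im},
      {τ | ‖MvPolynomial.eval a q‖ * s.im ^ N ≤ ‖MvPolynomial.eval (s • a - u τ) q‖} := by
    ext τ
    simp only [hA, Set.mem_ofPred_eq, Set.mem_iInter]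
    refine ⟨fun h s hs => norm_eval_ge_of_roots hq ha h s hs, fun h s hs => ?_⟩
    rcases hs.eq_or_lt with hs' | hs'
    · have := hreal τ s.re
      rwa [show (s.re : ℂ) = s from Complex.ext rfl (by simpa using hs')] at this
    · intro h'
      have := h s hs
      rw [h', norm_zero] at this
      have : 0 < ‖MvPolynomial.eval a q‖ * s.im ^ N := by
        have := norm_pos_iff.2 ha
        positivity
      linarith
  have hclosed : IsClosed A := by
    rw [hA']
    refine isClosed_biInter fun s _ => isClosed_le continuous_const ?_
    exact (continuous_eval_left (continuous_const.sub hu)).norm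
  have hopen : IsOpen A := by
    -- Homogenizing s a - u to s a - σ u compactifies the closed half-plane: σ = 0 is the point at
    -- infinity, where q(a) ≠ 0 prevents vanishing. Nonvanishing on a compact set is an open
    -- condition.
    set K : Set (ℝ × ℂ) := (Set.Icc 0 1 ×ˢ (Metric.closedBall 0 1 ∩ {s : ℂ | 0 ≤ s.im})) ∩
      {y | y.1 + ‖y.2‖ = 1} with hK
    have hKc : IsCompact K := by
      refine IsCompact.inter_right (isCompact_Icc.prod ((isCompact_closedBall _ _).inter_right ?_))
        ?_
      · exact isClosed_le continuous_const Complex.continuous_im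
      · exact isClosed_eq (by fun_prop) continuous_const
    have hAK : A = {τ | ∀ y ∈ K, MvPolynomial.eval (y.2 • a - (y.1 : ℂ) • u τ) q ≠ 0} := by
      ext τ
      simp only [hA, Set.mem_ofPred_eq]
      constructor
      · rintro h ⟨σ, s⟩ ⟨⟨hσ, -, hs⟩, hσs⟩
        simp only [Set.mem_ofPred_eq] at hs hσs hσ ⊢
        rcases hσ.1.eq_or_lt with h' | h'
        · subst h'
          have hs0 : s ≠ 0 := by rintro rfl; simp at hσs
          rw [Complex.ofReal_zero, zero_smul, sub_zero, hq.eval_smul_eq]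
          exact mul_ne_zero (pow_ne_zero _ hs0) ha
        · have hσ0 : (σ : ℂ) ≠ 0 := by exact_mod_cast h'.ne'
          have : s • a - (σ : ℂ) • u τ = (σ : ℂ) • ((s / σ) • a - u τ) := by
            rw [smul_sub, smul_smul, mul_div_cancel₀ _ hσ0]
          rw [this, hq.eval_smul_eq]
          refine mul_ne_zero (pow_ne_zero _ hσ0) (h _ ?_)
          rw [Complex.div_ofReal_im]
          positivity
      · intro h s hs
        set σ : ℝ := (1 + ‖s‖)⁻¹ with hσ
        have hpos : 0 < 1 + ‖s‖ := by positivity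
        have hσpos : 0 < σ := inv_pos.2 hpos
        have hσs : σ * (1 + ‖s‖) = 1 := inv_mul_cancel₀ hpos.ne'
        have hn : ‖(σ : ℂ) * s‖ = σ * ‖s‖ := by
          rw [norm_mul, Complex.norm_real, Real.norm_of_nonneg hσpos.le]
        have hns : 0 ≤ σ * ‖s‖ := by positivity
        have := h (σ, σ * s) ⟨⟨⟨hσpos.le, by nlinarith⟩, by
          rw [mem_closedBall_zero_iff, hn]; nlinarith, by
          simp only [Set.mem_ofPred_eq, Complex.im_ofReal_mul]
          positivity⟩, by
          simp only [Set.mem_ofPred_eq, hn]; linarith⟩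
        simp only at this
        rw [mul_smul, ← smul_sub, hq.eval_smul_eq] at this
        exact right_ne_zero_of_mul this
    rw [hAK, isOpen_iff_mem_nhds]
    intro τ hτ
    refine hKc.eventually_forall_of_forall_eventually fun y hy => ?_
    have hc : Continuous fun z : ℝ × (ℝ × ℂ) =>
        MvPolynomial.eval (z.2.2 • a - (z.2.1 : ℂ) • u z.1) q :=
      continuous_eval_left (by fun_prop)
    exact hc.continuousAt.eventually_ne (hτ y hy)
  have hAu : A = Set.univ := IsClopen.eq_univ ⟨hclosed, hopen⟩ ⟨0, h0⟩
  have : τ ∈ A := hAu ▸ Set.mem_univ τ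
  exact this s hs

end Homotopy

end HypPoly

namespace HypPoly

/-! ### Gårding's theorem -/

section Garding

variable {ι : Type*} [Fintype ι] {q : MvPolynomial ι ℝ} {N : ℕ}

/-- The value of a real polynomial at a complex point. -/
noncomputable def evalC {ι : Type*} (q : MvPolynomial ι ℝ) (v : ι → ℂ) : ℂ :=
  MvPolynomial.eval v (MvPolynomial.map Complex.ofRealHom q)

/-- The complex point underlying a real point. -/
def toC {ι : Type*} (v : ι → ℝ) : ι → ℂ := fun i => (v i : ℂ)

theorem evalC_toC {ι : Type*} (q : MvPolynomial ι ℝ) (v : ι → ℝ) :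
    evalC q (toC v) = (MvPolynomial.eval v q : ℝ) := by
  have := MvPolynomial.map_eval Complex.ofRealHom v q
  exact this.symm

theorem evalC_smul (hq : q.IsHomogeneous N) (t : ℂ) (v : ι → ℂ) :
    evalC q (t • v) = t ^ N * evalC q v :=
  (hq.map Complex.ofRealHom).eval_smul_eq t v

theorem evalC_ne_zero_of_path (hq : q.IsHomogeneous N) {a : ι → ℝ}
    (ha : MvPolynomial.eval a q ≠ 0) {u : ℝ → ι → ℂ} (hu : Continuous u)
    (hreal : ∀ (τ s : ℝ), evalC q ((s : ℂ) • toC a - u τ) ≠ 0)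
    (h0 : ∀ s : ℂ, 0 ≤ s.im → evalC q (s • toC a - u 0) ≠ 0) (τ : ℝ) (s : ℂ)
    (hs : 0 ≤ s.im) : evalC q (s • toC a - u τ) ≠ 0 := by
  have ha' : evalC q (toC a) ≠ 0 := by
    rw [evalC_toC]; exact_mod_cast ha
  exact eval_ne_zero_of_path (hq.map Complex.ofRealHom) ha' hu hreal h0 τ s hs

variable {e : ι → ℝ}

/-- After division by s, a nonreal z/s is excluded by hyperbolicity along e. A real z/s is
nonnegative, because Im z > 0 and Im s ≥ 0, and is excluded by `ha`. -/
theorem evalC_upper_ne_zero (hq : q.IsHomogeneous N) (he : MvPolynomial.eval e q ≠ 0)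
    (h : ∀ (x : ι → ℝ) (z : ℂ), z.im ≠ 0 → evalC q (z • toC e + toC x) ≠ 0) {a : ι → ℝ}
    (ha : ∀ t : ℝ, 0 ≤ t → MvPolynomial.eval (t • e + a) q ≠ 0) {z s : ℂ} (hz : 0 < z.im)
    (hs : 0 ≤ s.im) : evalC q (z • toC e + s • toC a) ≠ 0 := by
  by_cases hs0 : s = 0
  · have hz0 : z ≠ 0 := by rintro rfl; simp at hz
    rw [hs0, zero_smul, add_zero, evalC_smul hq, evalC_toC]
    exact mul_ne_zero (pow_ne_zero _ hz0) (by exact_mod_cast he)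
  have : z • toC e + s • toC a = s • ((z / s) • toC e + toC a) := by
    rw [smul_add, smul_smul, mul_div_cancel₀ _ hs0]
  rw [this, evalC_smul hq]
  refine mul_ne_zero (pow_ne_zero _ hs0) ?_
  by_cases hi : (z / s).im = 0
  · have hr : z / s = ((z / s).re : ℂ) := Complex.ext rfl (by simpa using hi)
    set ρ := (z / s).re
    have hzs : z = ρ * s := by rw [← hr, div_mul_cancel₀ _ hs0]
    have him : z.im = ρ * s.im := by rw [hzs, Complex.im_ofReal_mul]
    have hρ : 0 ≤ ρ := by
      by_contra hc
      nlinarith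
    have hv : (ρ : ℂ) • toC e + toC a = toC (ρ • e + a) := by
      ext i; simp [toC]
    rw [hr, hv, evalC_toC]
    exact_mod_cast ha ρ hρ
  · exact h a _ hi

/-- Move along ze + τy from τ = 0 to τ = 1: for real s the point sa + τy is real, so hyperbolicity
along e with z nonreal keeps the roots off the real axis. -/
theorem evalC_upper_add_ne_zero (hq : q.IsHomogeneous N) (he : MvPolynomial.eval e q ≠ 0)
    (h : ∀ (x : ι → ℝ) (z : ℂ), z.im ≠ 0 → evalC q (z • toC e + toC x) ≠ 0) {a : ι → ℝ}
    (ha : ∀ t : ℝ, 0 ≤ t → MvPolynomial.eval (t • e + a) q ≠ 0) {z s : ℂ} (hz : 0 < z.im)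
    (hs : 0 ≤ s.im) (y : ι → ℝ) : evalC q (z • toC e + s • toC a + toC y) ≠ 0 := by
  have ha0 : MvPolynomial.eval a q ≠ 0 := by simpa using ha 0 le_rfl
  have key := evalC_ne_zero_of_path hq ha0
    (u := fun τ => -(z • toC e + (τ : ℂ) • toC y)) (by fun_prop) ?_ ?_ 1 s hs
  · convert key using 2
    simp only [Complex.ofReal_one, one_smul]
    abel
  · intro τ s
    have := h (s • a + τ • y) z hz.ne'
    convert this using 2
    ext i; simp [toC]; ring
  · intro s hs
    have := evalC_upper_ne_zero hq he h ha hz hs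
    convert this using 2
    simp only [Complex.ofReal_zero, zero_smul]
    abel

/-- Gårding: the open hyperbolicity cone is closed under addition, up to its boundary. -/
theorem eval_add_ne_zero (hq : q.IsHomogeneous N) (he : MvPolynomial.eval e q ≠ 0)
    (h : ∀ (x : ι → ℝ) (z : ℂ), z.im ≠ 0 → evalC q (z • toC e + toC x) ≠ 0) {a y : ι → ℝ}
    (ha : ∀ t : ℝ, 0 ≤ t → MvPolynomial.eval (t • e + a) q ≠ 0)
    (hy : ∀ t : ℝ, 0 ≤ t → MvPolynomial.eval (t • e + y) q ≠ 0) {t : ℝ} (ht : 0 < t) :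
    MvPolynomial.eval (t • e + (a + y)) q ≠ 0 := by
  have hy0 : MvPolynomial.eval y q ≠ 0 := by simpa using hy 0 le_rfl
  have hz : 0 < (Complex.I * t).im := by simpa using ht
  -- The path adds iτa to ite, with s multiplying y. At τ = 1, s = i the point is i(te + a + y), and
  -- i factors out by homogeneity. The absolute value keeps the coefficient of a in the closed upper
  -- half-plane for all real τ.
  have key := evalC_ne_zero_of_path hq hy0
    (u := fun τ => -((Complex.I * t) • toC e + (((|τ| : ℝ) : ℂ) * Complex.I) • toC a))
    (by fun_prop) ?_ ?_ 1 Complex.I (by simp)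
  · have hv : Complex.I • toC y - -((Complex.I * t) • toC e +
        (((|1| : ℝ) : ℂ) * Complex.I) • toC a) = Complex.I • toC (t • e + (a + y)) := by
      ext i; simp [toC]; ring
    rw [hv] at key
    have := right_ne_zero_of_mul ((evalC_smul hq _ _).symm.trans_ne key)
    rw [evalC_toC] at this
    exact_mod_cast this
  · intro τ s
    have := evalC_upper_add_ne_zero hq he h ha hz (s := ((|τ| : ℝ) : ℂ) * Complex.I)
      (by simp) (s • y)
    convert this using 2
    ext i; simp [toC]; ring
  · intro s hs
    have := evalC_upper_ne_zero hq he h hy hz hs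
    convert this using 2
    simp only [abs_zero, Complex.ofReal_zero, zero_mul, zero_smul]
    abel

end Garding

/-! ### Symmetric functions of the eigenvalues -/

section Spectrum

variable {ι : Type*} {n : ℕ}

/-- `μ` enumerates the roots of `t ↦ p (t e - x)`, with multiplicity. -/
def HasSpectrum (p : MvPolynomial ι ℝ) (e x : ι → ℝ) (μ : Fin n → ℝ) : Prop :=
  pencil p e x = Polynomial.C (MvPolynomial.eval e p) * ∏ i, (Polynomial.X - Polynomial.C (μ i))

variable {p : MvPolynomial ι ℝ} {e x : ι → ℝ} {μ : Fin n → ℝ}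

theorem hasSpectrum_iff : HasSpectrum p e x μ ↔
    ∀ t, MvPolynomial.eval (t • e - x) p = MvPolynomial.eval e p * ∏ i, (t - μ i) := by
  constructor
  · intro h t
    rw [← eval_pencil, h]
    simp [Polynomial.eval_prod]
  · intro h
    refine Polynomial.funext fun t => ?_
    rw [eval_pencil, h]
    simp [Polynomial.eval_prod]

theorem HasSpectrum.translate (h : HasSpectrum p e x μ) (r : ℝ) :
    HasSpectrum p e (r • e + x) fun i => r + μ i := by
  rw [hasSpectrum_iff] at h ⊢
  intro t
  rw [show t • e - (r • e + x) = (t - r) • e - x by rw [sub_smul]; abel, h]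
  simp [sub_sub]

theorem HasSpectrum.smul [Fintype ι] (hp : p.IsHomogeneous n) (h : HasSpectrum p e x μ) (r : ℝ) :
    HasSpectrum p e (r • x) fun i => r * μ i := by
  rw [hasSpectrum_iff] at h ⊢
  by_cases hr : r = 0
  · intro t; simp [hr, hp.eval_smul_eq, mul_comm]
  intro t
  rw [show t • e - r • x = r • ((t / r) • e - x) by
    rw [smul_sub, smul_smul, mul_div_cancel₀ _ hr], hp.eval_smul_eq, h]
  have : ∀ i, t - r * μ i = r * (t / r - μ i) := fun i => by field_simp
  simp only [this, Finset.prod_mul_distrib, Finset.prod_const, Finset.card_univ, Fintype.card_fin]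
  ring

theorem HasSpectrum.exists_eq (he : MvPolynomial.eval e p ≠ 0) {μ' : Fin n → ℝ}
    (h : HasSpectrum p e x μ) (h' : HasSpectrum p e x μ') (i : Fin n) : ∃ j, μ i = μ' j := by
  have h1 := (hasSpectrum_iff.1 h) (μ i)
  rw [hasSpectrum_iff.1 h', Finset.prod_eq_zero (Finset.mem_univ i) (f := fun j => μ i - μ j)
    (sub_self _), mul_zero] at h1
  obtain ⟨j, -, hj⟩ := Finset.prod_eq_zero_iff.1 ((mul_eq_zero.1 h1).resolve_left he)
  exact ⟨j, sub_eq_zero.1 hj⟩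

/-- Symmetric functions of the spectrum are polynomials in the point. -/
theorem exists_eval_eq_of_isSymmetric [Fintype ι] (hp : p.IsHomogeneous n)
    (he : MvPolynomial.eval e p ≠ 0)
    (hex : ∀ x, ∃ μ : Fin n → ℝ, HasSpectrum p e x μ) {Ψ : MvPolynomial (Fin n) ℝ} {N : ℕ}
    (hsym : Ψ.IsSymmetric) (hΨ : Ψ.IsHomogeneous N) :
    ∃ q : MvPolynomial ι ℝ, q.IsHomogeneous N ∧
      ∀ (x : ι → ℝ) (μ : Fin n → ℝ), HasSpectrum p e x μ →
        MvPolynomial.eval x q = MvPolynomial.eval μ Ψ := by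
  obtain ⟨Φ, hΦ⟩ := MvPolynomial.esymmAlgHom_surjective (σ := Fin n) ℝ (n := n) (by simp)
    ⟨Ψ, hsym⟩
  have hΦ' : MvPolynomial.aeval (fun i : Fin n => MvPolynomial.esymm (Fin n) ℝ (i + 1)) Φ = Ψ := by
    have := congrArg Subtype.val hΦ
    rwa [MvPolynomial.esymmAlgHom_apply] at this
  -- The polynomial p(te - x) with x kept generic, so its coefficients in t are polynomials in x.
  set gen : Polynomial (MvPolynomial ι ℝ) :=
    pencil (MvPolynomial.map MvPolynomial.C p) (fun i => MvPolynomial.C (e i)) MvPolynomial.X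
  have hgen : ∀ x, gen.map (MvPolynomial.eval x) = pencil p e x := by
    intro x
    rw [map_pencil, MvPolynomial.map_map]
    congr 1
    · have : (MvPolynomial.eval x).comp MvPolynomial.C = RingHom.id ℝ := by ext; simp
      rw [this, MvPolynomial.map_id]
    · ext i; simp
    · ext i; simp
  -- Vieta: index j stands for the elementary symmetric function of degree j + 1.
  set E : Fin n → MvPolynomial ι ℝ := fun j =>
    MvPolynomial.C ((-1) ^ (j + 1 : ℕ) / MvPolynomial.eval e p) * gen.coeff (n - (j + 1))
  have hE : ∀ x μ, HasSpectrum p e x μ → ∀ j, MvPolynomial.eval x (E j) =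
      MvPolynomial.eval μ (MvPolynomial.esymm (Fin n) ℝ (j + 1)) := by
    intro x μ h j
    have hc : MvPolynomial.eval x (gen.coeff (n - (j + 1))) =
        MvPolynomial.eval e p * ((-1) ^ (j + 1 : ℕ) *
          MvPolynomial.eval μ (MvPolynomial.esymm (Fin n) ℝ (j + 1))) := by
      rw [← Polynomial.coeff_map, hgen, h, Polynomial.coeff_C_mul]
      have hv := (Multiset.map μ Finset.univ.1).prod_X_sub_C_coeff (k := n - (j + 1)) (by simp)
      have hj : n - (n - (j + 1 : ℕ)) = j + 1 := by omega
      rw [Multiset.map_map] at hv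
      simp only [Multiset.card_map, Finset.card_val, Finset.card_univ, Fintype.card_fin, hj] at hv
      have ha := MvPolynomial.aeval_esymm_eq_multiset_esymm (Fin n) ℝ (S := ℝ) (j + 1) μ
      rw [← ha] at hv
      rw [MvPolynomial.aeval_eq_eval] at hv
      exact congrArg _ hv
    simp only [E, map_mul, MvPolynomial.eval_C, hc]
    rw [← mul_assoc, div_mul_cancel₀ _ he, ← mul_assoc, ← mul_pow]
    simp
  have hq : ∀ x μ, HasSpectrum p e x μ →
      MvPolynomial.eval x (MvPolynomial.bind₁ E Φ) = MvPolynomial.eval μ Ψ := by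
    intro x μ h
    have h1 := MvPolynomial.aeval_bind₁ x E Φ
    have h2 := MvPolynomial.aeval_bind₁ μ
      (fun i : Fin n => MvPolynomial.esymm (Fin n) ℝ (i + 1)) Φ
    rw [MvPolynomial.aeval_eq_eval, MvPolynomial.aeval_eq_eval] at h1 h2
    rw [h1, ← hΦ']
    refine Eq.trans ?_ h2.symm
    congr 2
    ext j
    exact hE x μ h j
  refine ⟨MvPolynomial.bind₁ E Φ, MvPolynomial.isHomogeneous_of_eval_smul fun t x => ?_, hq⟩
  obtain ⟨μ, h⟩ := hex x
  rw [hq x μ h, hq _ _ (h.smul hp t), ← hΨ.eval_smul_eq]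
  rfl

end Spectrum

end HypPoly

namespace HypPoly

/-! ### Subadditivity of weighted eigenvalue sums -/

section Sublinear

variable {n : ℕ}

/-- The product of the linear forms `∑ c (σ i) X i` over all permutations `σ`. -/
noncomputable def permProd (c : Fin n → ℝ) : MvPolynomial (Fin n) ℝ :=
  ∏ σ : Equiv.Perm (Fin n), ∑ i, MvPolynomial.C (c (σ i)) * MvPolynomial.X i

theorem isSymmetric_permProd (c : Fin n → ℝ) : (permProd c).IsSymmetric := by
  intro τ
  rw [permProd, map_prod]
  simp only [map_sum, map_mul, MvPolynomial.rename_C, MvPolynomial.rename_X]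
  refine Fintype.prod_equiv (Equiv.mulRight τ⁻¹) _ _ fun σ => ?_
  refine Fintype.sum_equiv τ _ _ fun i => ?_
  simp

theorem isHomogeneous_permProd (c : Fin n → ℝ) :
    (permProd c).IsHomogeneous (Fintype.card (Equiv.Perm (Fin n))) := by
  have h : ∀ σ ∈ (Finset.univ : Finset (Equiv.Perm (Fin n))),
      (∑ i, MvPolynomial.C (c (σ i)) * MvPolynomial.X i :
        MvPolynomial (Fin n) ℝ).IsHomogeneous 1 := by
    intro σ _
    refine MvPolynomial.IsHomogeneous.sum _ _ _ fun i _ => ?_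
    simpa using (MvPolynomial.isHomogeneous_C _ (c (σ i))).mul (MvPolynomial.isHomogeneous_X ℝ i)
  simpa [permProd] using MvPolynomial.IsHomogeneous.prod _ _ _ h

theorem eval_permProd (c μ : Fin n → ℝ) :
    MvPolynomial.eval μ (permProd c) = ∏ σ : Equiv.Perm (Fin n), ∑ i, c (σ i) * μ i := by
  simp [permProd, map_prod]

variable {ι : Type*} [Fintype ι] {p : MvPolynomial ι ℝ} {e : ι → ℝ}

theorem evalC_ne_zero_of_eval_eq_prod {ι α : Type*} [Fintype α] {q : MvPolynomial ι ℝ}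
    {e x : ι → ℝ} {S : ℝ} (hS : S ≠ 0) {w : α → ℝ}
    (h : ∀ t : ℝ, MvPolynomial.eval (t • e + x) q = ∏ σ, (t * S + w σ)) {z : ℂ} (hz : z.im ≠ 0) :
    evalC q (z • toC e + toC x) ≠ 0 := by
  have hP : pencil q e (-x) = ∏ σ, (Polynomial.X * Polynomial.C S + Polynomial.C (w σ)) := by
    refine Polynomial.funext fun t => ?_
    rw [eval_pencil, sub_neg_eq_add, h]
    simp only [Polynomial.eval_prod, Polynomial.eval_add, Polynomial.eval_mul, Polynomial.eval_X,
      Polynomial.eval_C]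
  have hv : evalC q (z • toC e + toC x) =
      ((pencil q e (-x)).map Complex.ofRealHom).eval z := by
    rw [map_pencil, eval_pencil, evalC]
    congr 2
    ext i
    simp [toC]
  rw [hv, hP]
  simp only [Polynomial.map_prod, Polynomial.eval_prod]
  refine Finset.prod_ne_zero_iff.2 fun σ _ h0 => ?_
  have := congrArg Complex.im h0
  simp [hz, hS] at this

theorem hasSpectrum_self (hp : p.IsHomogeneous n) :
    HasSpectrum p e e (fun _ : Fin n => 1) := by
  rw [hasSpectrum_iff]
  intro t
  rw [show t • e - e = (t - 1) • e by rw [sub_smul, one_smul], hp.eval_smul_eq]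
  simp [mul_comm]

/-- Gårding's theorem for the polynomial q whose value is the product of all permuted sums: an upper
bound M on these sums at x puts ((M + ε)/S)e - x in the open cone of q. -/
theorem HasSpectrum.sum_mul_le_add (hp : p.IsHomogeneous n) (he : MvPolynomial.eval e p ≠ 0)
    (hex : ∀ x, ∃ μ : Fin n → ℝ, HasSpectrum p e x μ) {c : Fin n → ℝ} (hc : 0 < ∑ i, c i)
    {x y : ι → ℝ} {μ ν ω : Fin n → ℝ} (hx : HasSpectrum p e x μ) (hy : HasSpectrum p e y ν)
    (hxy : HasSpectrum p e (x + y) ω) {M M' : ℝ}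
    (hM : ∀ σ : Equiv.Perm (Fin n), ∑ i, c (σ i) * μ i ≤ M)
    (hM' : ∀ σ : Equiv.Perm (Fin n), ∑ i, c (σ i) * ν i ≤ M') (σ : Equiv.Perm (Fin n)) :
    ∑ i, c (σ i) * ω i ≤ M + M' := by
  set S := ∑ i, c i with hS
  obtain ⟨q, hq, hqe⟩ := exists_eval_eq_of_isSymmetric hp he hex (isSymmetric_permProd c)
    (isHomogeneous_permProd c)
  simp only [eval_permProd] at hqe
  have hsum : ∀ (t : ℝ) (μ : Fin n → ℝ) (σ : Equiv.Perm (Fin n)),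
      ∑ i, c (σ i) * (t + μ i) = t * S + ∑ i, c (σ i) * μ i := by
    intro t μ σ
    simp only [mul_add, Finset.sum_add_distrib]
    rw [← Finset.sum_mul, Equiv.sum_comp σ c, mul_comm]
  have htr : ∀ {x : ι → ℝ} {μ : Fin n → ℝ}, HasSpectrum p e x μ → ∀ t : ℝ,
      MvPolynomial.eval (t • e + x) q =
        ∏ σ : Equiv.Perm (Fin n), (t * S + ∑ i, c (σ i) * μ i) := by
    intro x μ h t
    rw [hqe _ _ (h.translate t)]
    exact Finset.prod_congr rfl fun σ _ => hsum t μ σ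
  have hqe0 : MvPolynomial.eval e q ≠ 0 := by
    rw [hqe _ _ (hasSpectrum_self hp)]
    refine Finset.prod_ne_zero_iff.2 fun σ _ => ?_
    simp only [mul_one]
    rw [Equiv.sum_comp σ c]
    exact hc.ne'
  have hyp : ∀ (x : ι → ℝ) (z : ℂ), z.im ≠ 0 → evalC q (z • toC e + toC x) ≠ 0 := by
    intro x z hz
    obtain ⟨μ, h⟩ := hex x
    exact evalC_ne_zero_of_eval_eq_prod hc.ne' (htr h) hz
  have hrefl : ∀ {x : ι → ℝ} {μ : Fin n → ℝ}, HasSpectrum p e x μ → ∀ t : ℝ,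
      MvPolynomial.eval (t • e - x) q =
        ∏ σ : Equiv.Perm (Fin n), (t * S - ∑ i, c (σ i) * μ i) := by
    intro x μ h t
    have := htr (h.smul hp (-1)) t
    rw [neg_one_smul, ← sub_eq_add_neg] at this
    rw [this]
    refine Finset.prod_congr rfl fun σ _ => ?_
    rw [sub_eq_add_neg, ← Finset.sum_neg_distrib]
    congr 1
    exact Finset.sum_congr rfl fun i _ => by ring
  have hpos : ∀ {x : ι → ℝ} {μ : Fin n → ℝ}, HasSpectrum p e x μ → ∀ {M ε : ℝ}, 0 < ε →
      (∀ σ : Equiv.Perm (Fin n), ∑ i, c (σ i) * μ i ≤ M) → ∀ t : ℝ, 0 ≤ t →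
      MvPolynomial.eval (t • e + (((M + ε) / S) • e - x)) q ≠ 0 := by
    intro x μ h M ε hε hM t ht
    rw [← add_sub_assoc, ← add_smul, hrefl h]
    refine Finset.prod_ne_zero_iff.2 fun σ _ => ?_
    have h1 : (t + (M + ε) / S) * S = t * S + (M + ε) := by field_simp
    have h2 : 0 ≤ t * S := by positivity
    have := hM σ
    rw [h1]
    linarith
  by_contra! hlt
  -- The two cone elements spend one ε each and the extra multiple of e spends 2ε. The total, M + M'
  -- + 4ε, is exactly the offending sum, at which the factor for σ vanishes.
  set ε := (∑ i, c (σ i) * ω i - (M + M')) / 4 with hε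
  have hε0 : 0 < ε := by rw [hε]; linarith
  have key := eval_add_ne_zero hq hqe0 hyp (hpos hx hε0 hM) (hpos hy hε0 hM')
    (t := 2 * ε / S) (by positivity)
  have hv : (2 * ε / S) • e + (((M + ε) / S) • e - x + (((M' + ε) / S) • e - y)) =
      (2 * ε / S + (M + ε) / S + (M' + ε) / S) • e - (x + y) := by
    rw [add_smul, add_smul]; abel
  rw [hv, hrefl hxy] at key
  refine Finset.prod_ne_zero_iff.1 key σ (Finset.mem_univ _) ?_
  have h1 : (2 * ε / S + (M + ε) / S + (M' + ε) / S) * S = 2 * ε + (M + ε) + (M' + ε) := by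
    field_simp
  rw [h1, hε]
  ring

end Sublinear

/-! ### Quadratic forms from polynomials of degree two -/

section Quadratic

variable {ι : Type*} [Fintype ι]

theorem exists_bilin_of_degree_two {d : ι →₀ ℕ} (hd : d.degree = 2) :
    ∃ B : (ι → ℝ) →ₗ[ℝ] (ι → ℝ) →ₗ[ℝ] ℝ, ∀ v : ι → ℝ, ∏ i, v i ^ d i = B v v := by
  classical
  have hcard : (Finsupp.toMultiset d).card = 2 := by
    rw [Finsupp.card_toMultiset, ← hd]; rfl
  obtain ⟨i, j, hij⟩ := Multiset.card_eq_two.1 hcard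
  have hd' : d = Finsupp.single i 1 + Finsupp.single j 1 := by
    apply Multiset.toFinsupp.symm.injective
    change Finsupp.toMultiset d = Finsupp.toMultiset _
    rw [hij, map_add, Finsupp.toMultiset_single, Finsupp.toMultiset_single, one_smul, one_smul]
    rfl
  refine ⟨(LinearMap.mul ℝ ℝ).compl₁₂ (LinearMap.proj i) (LinearMap.proj j), fun v => ?_⟩
  subst hd'
  simp only [Finsupp.add_apply, pow_add, Finset.prod_mul_distrib, LinearMap.compl₁₂_apply,
    LinearMap.proj_apply, LinearMap.mul_apply']
  congr 1 <;> simp [Finsupp.single_apply]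

theorem exists_bilin_of_isHomogeneous_two {q : MvPolynomial ι ℝ} (hq : q.IsHomogeneous 2) :
    ∃ B : (ι → ℝ) →ₗ[ℝ] (ι → ℝ) →ₗ[ℝ] ℝ, ∀ v : ι → ℝ, MvPolynomial.eval v q = B v v := by
  have hdeg : ∀ d ∈ q.support, ∃ B : (ι → ℝ) →ₗ[ℝ] (ι → ℝ) →ₗ[ℝ] ℝ,
      ∀ v : ι → ℝ, ∏ i, v i ^ d i = B v v := by
    intro d hd
    refine exists_bilin_of_degree_two ?_
    rw [Finsupp.degree_eq_weight_one]
    exact hq (MvPolynomial.mem_support_iff.1 hd)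
  choose! B hB using hdeg
  refine ⟨∑ d ∈ q.support, q.coeff d • B d, fun v => ?_⟩
  rw [MvPolynomial.eval_eq']
  simp only [LinearMap.sum_apply, LinearMap.smul_apply, smul_eq_mul]
  exact Finset.sum_congr rfl fun d hd => by rw [hB d hd]

end Quadratic

end HypPoly

namespace HypPoly

/-! ### The eigenvalue map and its cone -/

section Eigenvalues

variable {V : Type*} [AddCommGroup V] [Module ℝ V] {ι : Type*}
  {b : Module.Basis ι ℝ V} {p : MvPolynomial ι ℝ} {n : ℕ} {e : V}

theorem IsHyperbolic.splits (hp : IsHyperbolic b p n e) (x : V) : (linePoly b p e x).Splits := by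
  refine Polynomial.Splits.of_splits_map (algebraMap ℝ ℂ) (IsAlgClosed.splits _) fun z hz => ?_
  have h0 : Polynomial.aeval z (linePoly b p e x) = 0 := by
    rw [Polynomial.aeval_def, ← Polynomial.eval_map]
    exact (Polynomial.mem_roots'.1 hz).2
  exact ⟨z.re, Complex.ext rfl (by simpa using (hp.roots_real x z h0).symm)⟩

theorem norm_sq_eigenvalueMap (x : V) :
    ‖eigenvalueMap b p n e x‖ ^ 2 = ∑ i, eigenvalueMap b p n e x i ^ 2 :=
  EuclideanSpace.real_norm_sq_eq _

variable [Fintype ι]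

theorem linePoly_eq_pencil (x : V) :
    linePoly b p e x = pencil p (b.equivFun e) (b.equivFun x) := rfl

theorem IsHyperbolic.eval_ne_zero (hp : IsHyperbolic b p n e) :
    MvPolynomial.eval (b.equivFun e) p ≠ 0 := hp.value_ne_zero

theorem hasSpectrum_eigenvalueMap (hp : IsHyperbolic b p n e) (x : V) :
    HasSpectrum p (b.equivFun e) (b.equivFun x) (fun i => eigenvalueMap b p n e x i) := by
  obtain ⟨h1, h2⟩ := natDegree_pencil hp.homogeneous (b.equivFun x) hp.eval_ne_zero
  rw [← linePoly_eq_pencil] at h1 h2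
  have hs := hp.splits x
  rw [HasSpectrum, ← linePoly_eq_pencil]
  conv_lhs => rw [hs.eq_prod_roots, h2]
  congr 1
  set l := (linePoly b p e x).roots.sort (· ≥ ·) with hl
  have hlen : l.length = n := by
    rw [hl, Multiset.length_sort, ← hs.natDegree_eq_card_roots, h1]
  have hroots : (linePoly b p e x).roots = (l : Multiset ℝ) := (Multiset.sort_eq _ _).symm
  rw [hroots, Multiset.map_coe, Multiset.prod_coe]
  change (l.map fun a => Polynomial.X - Polynomial.C a).prod =
    ∏ i : Fin n, (Polynomial.X - Polynomial.C (l.getD i 0))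
  clear_value l
  subst hlen
  rw [← List.prod_ofFn]
  congr 1
  refine List.ext_getElem (by simp) fun i hi _ => ?_
  simp

theorem antitone_eigenvalueMap (hp : IsHyperbolic b p n e) (x : V) :
    Antitone fun i => eigenvalueMap b p n e x i := by
  obtain ⟨h1, -⟩ := natDegree_pencil hp.homogeneous (b.equivFun x) hp.eval_ne_zero
  rw [← linePoly_eq_pencil] at h1
  have hlen : ((linePoly b p e x).roots.sort (· ≥ ·)).length = n := by
    rw [Multiset.length_sort, ← (hp.splits x).natDegree_eq_card_roots, h1]
  have hpw := Multiset.pairwise_sort (linePoly b p e x).roots (· ≥ ·)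
  intro i j hij
  change ((linePoly b p e x).roots.sort (· ≥ ·)).getD j 0 ≤
    ((linePoly b p e x).roots.sort (· ≥ ·)).getD i 0
  have hi := i.2.trans_eq hlen.symm
  have hj := j.2.trans_eq hlen.symm
  rw [List.getD_eq_getElem _ _ hi, List.getD_eq_getElem _ _ hj]
  rcases hij.eq_or_lt with rfl | hlt
  · exact le_rfl
  · exact List.pairwise_iff_getElem.1 hpw i j hi hj hlt

theorem exists_hasSpectrum (hp : IsHyperbolic b p n e) (x : ι → ℝ) :
    ∃ μ : Fin n → ℝ, HasSpectrum p (b.equivFun e) x μ := by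
  have := hasSpectrum_eigenvalueMap hp (b.equivFun.symm x)
  rw [LinearEquiv.apply_symm_apply] at this
  exact ⟨_, this⟩

/-- The sum of squares of the eigenvalues is a quadratic form. -/
theorem exists_bilin_eq_sum_sq (hp : IsHyperbolic b p n e) :
    ∃ B : V →ₗ[ℝ] V →ₗ[ℝ] ℝ, (∀ x y, B x y = B y x) ∧
      ∀ (x : V) (μ : Fin n → ℝ), HasSpectrum p (b.equivFun e) (b.equivFun x) μ →
        B x x = ∑ i, μ i ^ 2 := by
  obtain ⟨q, hq, hqe⟩ := exists_eval_eq_of_isSymmetric hp.homogeneous hp.eval_ne_zero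
    (exists_hasSpectrum hp) (MvPolynomial.psum_isSymmetric (Fin n) ℝ 2)
    (MvPolynomial.IsHomogeneous.sum _ _ 2 fun i _ => by
      simpa using (MvPolynomial.isHomogeneous_X ℝ i).pow 2)
  obtain ⟨B, hB⟩ := exists_bilin_of_isHomogeneous_two hq
  set C : V →ₗ[ℝ] V →ₗ[ℝ] ℝ := B.compl₁₂ b.equivFun.toLinearMap b.equivFun.toLinearMap with hC
  refine ⟨(1 / 2 : ℝ) • (C + C.flip), fun x y => ?_, fun x μ h => ?_⟩
  · simp [add_comm]
  · have h1 : C x x = ∑ i, μ i ^ 2 := by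
      rw [hC, LinearMap.compl₁₂_apply]
      simp only [LinearEquiv.coe_coe]
      rw [← hB, hqe _ _ h]
      simp [MvPolynomial.psum]
    simp only [LinearMap.smul_apply, LinearMap.add_apply, LinearMap.flip_apply, smul_eq_mul, h1]
    ring

/-- Adding e shifts every eigenvalue by 1, so expanding B(e + x, e + x) isolates the trace. This
shows that the trace is linear. -/
theorem bilin_apply_direction (hp : IsHyperbolic b p n e) {B : V →ₗ[ℝ] V →ₗ[ℝ] ℝ}
    (hsymm : ∀ x y, B x y = B y x)
    (hB : ∀ (x : V) (μ : Fin n → ℝ), HasSpectrum p (b.equivFun e) (b.equivFun x) μ →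
        B x x = ∑ i, μ i ^ 2) (x : V) :
    B x e = ∑ i, eigenvalueMap b p n e x i := by
  have hx := hasSpectrum_eigenvalueMap hp x
  have h1 := hB x _ hx
  have h2 := hB e _ (hasSpectrum_self hp.homogeneous)
  have h3 := hB (e + x) (fun i => 1 + eigenvalueMap b p n e x i) (by
    simpa using hx.translate 1)
  simp only [map_add, LinearMap.add_apply, h1, h2, hsymm e x, add_sq, Finset.sum_add_distrib,
    mul_one, ← Finset.mul_sum] at h3
  linarith

theorem sum_mul_eigenvalueMap_add_le (hp : IsHyperbolic b p n e) {c : Fin n → ℝ}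
    (hc : Antitone c) (x y : V) :
    ∑ i, c i * eigenvalueMap b p n e (x + y) i ≤
      ∑ i, c i * eigenvalueMap b p n e x i + ∑ i, c i * eigenvalueMap b p n e y i := by
  rcases Nat.eq_zero_or_pos n with rfl | hn
  · simp
  obtain ⟨B, hsymm, hB⟩ := exists_bilin_eq_sum_sq hp
  have htr := bilin_apply_direction hp hsymm hB
  have htradd : ∑ i, eigenvalueMap b p n e (x + y) i =
      ∑ i, eigenvalueMap b p n e x i + ∑ i, eigenvalueMap b p n e y i := by
    rw [← htr, ← htr, ← htr, map_add, LinearMap.add_apply]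
  have hn' : (0 : ℝ) < n := by exact_mod_cast hn
  -- Shifting by κ makes the weights sum to 1; additivity of the trace cancels the shift at the end.
  set κ : ℝ := (1 - ∑ i, c i) / n with hκ
  have hsum : 0 < ∑ i, (c i + κ) := by
    rw [Finset.sum_add_distrib, Finset.sum_const, Finset.card_univ, Fintype.card_fin, nsmul_eq_mul,
      hκ, mul_div_cancel₀ _ hn'.ne']
    linarith
  have hmono : ∀ (z : V) (σ : Equiv.Perm (Fin n)),
      ∑ i, (c (σ i) + κ) * eigenvalueMap b p n e z i ≤
        ∑ i, (c i + κ) * eigenvalueMap b p n e z i := by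
    intro z σ
    refine Monovary.sum_comp_perm_mul_le_sum_mul (f := fun i => c i + κ) ?_
    exact Antitone.monovary (fun i j h => by simpa using hc h) (antitone_eigenvalueMap hp z)
  have key := HasSpectrum.sum_mul_le_add hp.homogeneous hp.eval_ne_zero (exists_hasSpectrum hp)
    hsum (hasSpectrum_eigenvalueMap hp x) (hasSpectrum_eigenvalueMap hp y)
    (by rw [← map_add]; exact hasSpectrum_eigenvalueMap hp (x + y)) (hmono x) (hmono y) 1
  simp only [Equiv.Perm.one_apply, add_mul, Finset.sum_add_distrib, ← Finset.mul_sum] at key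
  rw [htradd] at key
  linarith

/-- Subadditivity with weights λ(x+y), combined with ‖λ(x+y) - λ(x) - λ(y)‖² ≥ 0, bounds ‖λ(x+y)‖²
by ‖λ(x)+λ(y)‖². -/
theorem bilin_le_sum_mul (hp : IsHyperbolic b p n e) {B : V →ₗ[ℝ] V →ₗ[ℝ] ℝ}
    (hsymm : ∀ x y, B x y = B y x)
    (hB : ∀ (x : V) (μ : Fin n → ℝ), HasSpectrum p (b.equivFun e) (b.equivFun x) μ →
        B x x = ∑ i, μ i ^ 2) (x y : V) :
    B x y ≤ ∑ i, eigenvalueMap b p n e x i * eigenvalueMap b p n e y i := by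
  have hx := hB x _ (hasSpectrum_eigenvalueMap hp x)
  have hy := hB y _ (hasSpectrum_eigenvalueMap hp y)
  have hxy := hB (x + y) _ (hasSpectrum_eigenvalueMap hp (x + y))
  have hle := sum_mul_eigenvalueMap_add_le hp (antitone_eigenvalueMap hp (x + y)) x y
  have hsq : 0 ≤ ∑ i, (eigenvalueMap b p n e (x + y) i -
      (eigenvalueMap b p n e x i + eigenvalueMap b p n e y i)) ^ 2 :=
    Finset.sum_nonneg fun i _ => sq_nonneg _
  have hexp : ∑ i, (eigenvalueMap b p n e (x + y) i -
      (eigenvalueMap b p n e x i + eigenvalueMap b p n e y i)) ^ 2 =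
      ∑ i, eigenvalueMap b p n e (x + y) i ^ 2
      - 2 * (∑ i, eigenvalueMap b p n e (x + y) i * eigenvalueMap b p n e x i
        + ∑ i, eigenvalueMap b p n e (x + y) i * eigenvalueMap b p n e y i)
      + ∑ i, eigenvalueMap b p n e x i ^ 2 + ∑ i, eigenvalueMap b p n e y i ^ 2
      + 2 * ∑ i, eigenvalueMap b p n e x i * eigenvalueMap b p n e y i := by
    simp only [Finset.mul_sum, ← Finset.sum_add_distrib, ← Finset.sum_sub_distrib]
    exact Finset.sum_congr rfl fun i _ => by ring
  simp only [map_add, LinearMap.add_apply, hx, hy, hsymm y x] at hxy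
  simp only [← pow_two] at hle
  linarith

theorem eigenvalueMap_self (hp : IsHyperbolic b p n e) (i : Fin n) :
    eigenvalueMap b p n e e i = 1 := by
  obtain ⟨j, hj⟩ := (hasSpectrum_eigenvalueMap hp e).exists_eq hp.eval_ne_zero
    (hasSpectrum_self hp.homogeneous) i
  exact hj

theorem exists_eigenvalueMap_smul (hp : IsHyperbolic b p n e) (r : ℝ) (x : V) (i : Fin n) :
    ∃ j, eigenvalueMap b p n e (r • x) i = r * eigenvalueMap b p n e x j := by
  refine (hasSpectrum_eigenvalueMap hp (r • x)).exists_eq hp.eval_ne_zero ?_ i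
  rw [map_smul]
  exact (hasSpectrum_eigenvalueMap hp x).smul hp.homogeneous r

theorem exists_mul_eigenvalueMap (hp : IsHyperbolic b p n e) (r : ℝ) (x : V) (i : Fin n) :
    ∃ j, r * eigenvalueMap b p n e x i = eigenvalueMap b p n e (r • x) j := by
  refine HasSpectrum.exists_eq hp.eval_ne_zero
    ((hasSpectrum_eigenvalueMap hp x).smul hp.homogeneous r) ?_ i
  rw [← map_smul]
  exact hasSpectrum_eigenvalueMap hp (r • x)

theorem smul_mem_hyperbolicityCone (hp : IsHyperbolic b p n e) {r : ℝ} (hr : 0 ≤ r) {x : V}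
    (hx : x ∈ hyperbolicityCone b p n e) : r • x ∈ hyperbolicityCone b p n e := by
  intro i
  obtain ⟨j, hj⟩ := exists_eigenvalueMap_smul hp r x i
  rw [hj]
  exact mul_nonneg hr (hx j)

theorem add_mem_hyperbolicityCone (hp : IsHyperbolic b p n e) {x y : V}
    (hx : x ∈ hyperbolicityCone b p n e) (hy : y ∈ hyperbolicityCone b p n e) :
    x + y ∈ hyperbolicityCone b p n e := by
  intro i
  have hn : n - 1 < n := by have := i.2; omega
  set l : Fin n := ⟨n - 1, hn⟩
  have hl : ∀ j : Fin n, j ≤ l := fun j => by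
    have := j.2
    exact Fin.mk_le_mk.2 (by omega)
  -- These weights pick out minus the smallest eigenvalue, which is therefore superadditive.
  have hanti : Antitone fun j : Fin n => if j = l then (-1 : ℝ) else 0 := by
    intro j k hjk
    by_cases hj : j = l
    · have hk : k = l := le_antisymm (hl k) (hj ▸ hjk)
      simp [hj, hk]
    · simp only [if_neg hj]
      split_ifs <;> norm_num
  have := sum_mul_eigenvalueMap_add_le hp hanti x y
  simp only [ite_mul, zero_mul, Finset.sum_ite_eq', Finset.mem_univ, if_true] at this
  have h1 := antitone_eigenvalueMap hp (x + y) (hl i)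
  have h2 := hx l
  have h3 := hy l
  simp only at h1
  linarith

theorem mem_hyperbolicityCone_and_neg_mem_iff (hp : IsHyperbolic b p n e)
    (hc : IsComplete b p n e) (x : V) :
    x ∈ hyperbolicityCone b p n e ∧ -x ∈ hyperbolicityCone b p n e ↔ x = 0 := by
  constructor
  · rintro ⟨h1, h2⟩
    refine hc x ?_
    ext i
    refine le_antisymm ?_ (h1 i)
    obtain ⟨j, hj⟩ := exists_mul_eigenvalueMap hp (-1) x i
    rw [neg_one_smul] at hj
    have := h2 j
    change eigenvalueMap b p n e x i ≤ 0
    linarith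
  · rintro rfl
    have h0 : (0 : V) ∈ hyperbolicityCone b p n e := by
      intro i
      obtain ⟨j, hj⟩ := exists_eigenvalueMap_smul hp 0 (0 : V) i
      rw [zero_smul, zero_mul] at hj
      exact hj.ge
    exact ⟨h0, by rwa [neg_zero]⟩

theorem quarter_norm_sq_sub_eq (hp : IsHyperbolic b p n e) {B : V →ₗ[ℝ] V →ₗ[ℝ] ℝ}
    (hsymm : ∀ x y, B x y = B y x)
    (hB : ∀ (x : V) (μ : Fin n → ℝ), HasSpectrum p (b.equivFun e) (b.equivFun x) μ →
        B x x = ∑ i, μ i ^ 2) (x y : V) :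
    (1 / 4 : ℝ) * (‖eigenvalueMap b p n e (x + y)‖ ^ 2
      - ‖eigenvalueMap b p n e (x - y)‖ ^ 2) = B x y := by
  rw [norm_sq_eigenvalueMap, norm_sq_eigenvalueMap,
    ← hB _ _ (hasSpectrum_eigenvalueMap hp (x + y)),
    ← hB _ _ (hasSpectrum_eigenvalueMap hp (x - y))]
  simp only [map_add, map_sub, LinearMap.add_apply, LinearMap.sub_apply, hsymm y x]
  ring

end Eigenvalues

/-! ### Metric consequences -/

section InnerProduct

/-- Expanding squares gives ‖l x - l y‖ ≤ ‖x - y‖: the norms agree and the cross term can only grow.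
-/
theorem IsSemiFTvN.continuous {V W : Type*} [NormedAddCommGroup V] [InnerProductSpace ℝ V]
    [NormedAddCommGroup W] [InnerProductSpace ℝ W] {l : V → W} (h : IsSemiFTvN l) :
    Continuous l := by
  refine (LipschitzWith.of_dist_le_mul (K := 1) fun x y => ?_).continuous
  rw [dist_eq_norm, dist_eq_norm, NNReal.coe_one, one_mul]
  refine le_of_sq_le_sq ?_ (norm_nonneg _)
  rw [norm_sub_sq_real, norm_sub_sq_real, h.norm_map, h.norm_map]
  linarith [h.inner_le x y]

variable {V : Type*} [NormedAddCommGroup V] [InnerProductSpace ℝ V] {ι : Type*}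
  {b : Module.Basis ι ℝ V} {p : MvPolynomial ι ℝ} {n : ℕ} {e : V}

theorem continuous_eigenvalueMap_apply (hcont : Continuous (eigenvalueMap b p n e)) (i : Fin n) :
    Continuous fun x => eigenvalueMap b p n e x i :=
  (EuclideanSpace.proj (𝕜 := ℝ) i).continuous.comp hcont

variable [Fintype ι]

theorem isSemiFTvN_eigenvalueMap (hp : IsHyperbolic b p n e) {B : V →ₗ[ℝ] V →ₗ[ℝ] ℝ}
    (hsymm : ∀ x y, B x y = B y x)
    (hB : ∀ (x : V) (μ : Fin n → ℝ), HasSpectrum p (b.equivFun e) (b.equivFun x) μ →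
        B x x = ∑ i, μ i ^ 2)
    (hin : ∀ x y : V, inner ℝ x y = B x y) : IsSemiFTvN (eigenvalueMap b p n e) where
  norm_map x := by
    refine (pow_left_inj₀ (norm_nonneg _) (norm_nonneg _) two_ne_zero).1 ?_
    rw [norm_sq_eigenvalueMap, ← hB _ _ (hasSpectrum_eigenvalueMap hp x), ← hin,
      real_inner_self_eq_norm_sq]
  inner_le x y := by
    rw [hin, PiLp.inner_apply]
    refine (bilin_le_sum_mul hp hsymm hB x y).trans_eq (Finset.sum_congr rfl fun i _ => ?_)
    simp [mul_comm]

theorem isProperCone_hyperbolicityCone (hp : IsHyperbolic b p n e) (hc : IsComplete b p n e)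
    (hcont : Continuous (eigenvalueMap b p n e)) :
    IsProperCone (hyperbolicityCone b p n e) where
  isClosed := by
    have : hyperbolicityCone b p n e = ⋂ i, {x | 0 ≤ eigenvalueMap b p n e x i} := by
      ext x; simp [hyperbolicityCone]
    rw [this]
    exact isClosed_iInter fun i => isClosed_le continuous_const (continuous_eigenvalueMap_apply hcont i)
  convex x hx y hy s t hs ht _ := add_mem_hyperbolicityCone hp
    (smul_mem_hyperbolicityCone hp hs hx) (smul_mem_hyperbolicityCone hp ht hy)
  smul_mem _ ht _ hx := smul_mem_hyperbolicityCone hp ht hx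
  pointed := mem_hyperbolicityCone_and_neg_mem_iff hp hc
  interior_nonempty := by
    refine ⟨e, mem_interior.2 ⟨⋂ i, {x | 0 < eigenvalueMap b p n e x i}, ?_, ?_, ?_⟩⟩
    · intro x hx i
      exact (Set.mem_iInter.1 hx i).le
    · exact isOpen_iInter_of_finite fun i => isOpen_lt continuous_const (continuous_eigenvalueMap_apply hcont i)
    · refine Set.mem_iInter.2 fun i => ?_
      change 0 < eigenvalueMap b p n e e i
      rw [eigenvalueMap_self hp]
      exact one_pos

end InnerProduct

end HypPoly

theorem theorem5p2 {V : Type*} [AddCommGroup V] [Module ℝ V]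
    {ι : Type*} [Fintype ι] (b : Module.Basis ι ℝ V)
    (p : MvPolynomial ι ℝ) (n : ℕ) (e : V) (he : e ≠ 0)
    (hp : HypPoly.IsHyperbolic b p n e) (hc : HypPoly.IsComplete b p n e) :
    ∃ c : InnerProductSpace.Core ℝ V,
      (∀ x y : V, c.inner x y =
        (1 / 4 : ℝ) * (‖HypPoly.eigenvalueMap b p n e (x + y)‖ ^ 2
          - ‖HypPoly.eigenvalueMap b p n e (x - y)‖ ^ 2)) ∧
      (letI : NormedAddCommGroup V := c.toNormedAddCommGroup
       letI : InnerProductSpace ℝ V := InnerProductSpace.ofCore c.toCore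
       HypPoly.IsSemiFTvN (HypPoly.eigenvalueMap b p n e) ∧
       HypPoly.IsProperCone (HypPoly.hyperbolicityCone b p n e)) := by
  obtain ⟨B, hsymm, hB⟩ := HypPoly.exists_bilin_eq_sum_sq hp
  have hBself : ∀ x, B x x = ‖HypPoly.eigenvalueMap b p n e x‖ ^ 2 := fun x => by
    rw [HypPoly.norm_sq_eigenvalueMap, hB _ _ (HypPoly.hasSpectrum_eigenvalueMap hp x)]
  let c : InnerProductSpace.Core ℝ V :=
    { inner := fun x y => B x y
      conj_inner_symm := fun x y => hsymm y x
      re_inner_nonneg := fun x => by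
        change 0 ≤ B x x
        rw [hBself]
        positivity
      add_left := fun x y z => by
        change B (x + y) z = B x z + B y z
        rw [map_add, LinearMap.add_apply]
      smul_left := fun x y r => by
        change B (r • x) y = r * B x y
        rw [map_smul, LinearMap.smul_apply, smul_eq_mul]
      definite := fun x hx => by
        change B x x = 0 at hx
        rw [hBself] at hx
        exact hc x (norm_eq_zero.1 (pow_eq_zero_iff two_ne_zero |>.1 hx)) }
  refine ⟨c, fun x y => (HypPoly.quarter_norm_sq_sub_eq hp hsymm hB x y).symm, ?_⟩
  let _ : NormedAddCommGroup V := c.toNormedAddCommGroup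
  let _ : InnerProductSpace ℝ V := InnerProductSpace.ofCore c.toCore
  have h : HypPoly.IsSemiFTvN (HypPoly.eigenvalueMap b p n e) :=
    HypPoly.isSemiFTvN_eigenvalueMap hp hsymm hB fun _ _ => rfl
  exact ⟨h, HypPoly.isProperCone_hyperbolicityCone hp hc h.continuous⟩
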